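/- Let $X$ be a complex Hilbert space, let $M_1,M_2$ be closed subspaces of $X$ with orthogonal projections $P_1,P_2$, and let $$T=P_2P_1+(I-P_2)(I-P_1)$$ be the corresponding Douglas–Rachford operator. Let $P$ denote the orthogonal projection onto the closed subspace $(M_1\cap M_2)\oplus(M_1^\perp\cap M_2^\perp)$. Then: 1. For all $x\in X$, $\|T^nx-Px\|\to0$ as $n\to\infty$. 2. If $M_1+M_2$ is closed, then there exist $C>0$ and $r\in[0,1)$ such that $\|T^n-P\|\le Cr^n$ for all $n\ge0$ (where $0^0=1$). 3. If $M_1+M_2$ is not closed, then the convergence in 1 is arbitrarily slow and weakly arbitrarily slow. That is, for every sequence $(r_n)_{n\ge0}$ of non-negative real numbers with $r_n\to0$ there exists $x\in X$ such that $\|T^nx-Px\|\ge r_n$ for all $n\ge0$; and for every such sequence there exist $x\in X$ and a bounded linear functional $\phi\in X^*$ such that $\operatorname{Re}\phi(T^nx-Px)\ge r_n$ for all $n\ge0$. 4. In either case there exists a dense linear subspace $X_0$ of $X$ such that for all $x\in X_0$ the convergence in 1 is superpolynomially fast, that is, $\|T^nx-Px\|=o(n^{-k})$ as $n\to\infty$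 for every integer $k\ge1$. -/

import Mathlib

open Filter Topology Asymptotics

namespace DouglasRachford

variable {X : Type*} [NormedAddCommGroup X]

set_option linter.unusedSectionVars false

/-- The convergence `S n x → 0` (for all `x`) is *arbitrarily slow*: every null sequence of
non-negative scalars is dominated by some orbit `‖S n x‖`, at every index `n ≥ 0`. -/
def ArbitrarilySlow [NormedSpace ℂ X] (S : ℕ → X →L[ℂ] X) : Prop :=
  ∀ r : ℕ → ℝ, (∀ n, 0 ≤ r n) → Tendsto r atTop (𝓝 0) →
    ∃ x : X, ∀ n, r n ≤ ‖S n x‖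

/-- The convergence `S n x → 0` (for all `x`) is *weakly arbitrarily slow*: every null sequence of
non-negative scalars is dominated by some weak orbit `Re φ (S n x)`, at every index `n ≥ 0`. -/
def WeaklyArbitrarilySlow [NormedSpace ℂ X] (S : ℕ → X →L[ℂ] X) : Prop :=
  ∀ r : ℕ → ℝ, (∀ n, 0 ≤ r n) → Tendsto r atTop (𝓝 0) →
    ∃ (x : X) (φ : X →L[ℂ] ℂ), ∀ n, r n ≤ (φ (S n x)).re

/-- The convergence `S n x → 0` is *superpolynomially fast* for the vector `x`:
`‖S n x‖ = o(n ^ (-k))` as `n → ∞`, for every `k ≥ 1`. -/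
def SuperpolynomiallyFast [NormedSpace ℂ X] (S : ℕ → X →L[ℂ] X) (x : X) : Prop :=
  ∀ k : ℕ, 1 ≤ k → (fun n : ℕ => ‖S n x‖) =o[atTop] (fun n : ℕ => ((n : ℝ) ^ k)⁻¹)

variable [InnerProductSpace ℂ X] [CompleteSpace X]

/-- The Douglas–Rachford operator `T = P₂ P₁ + (I - P₂)(I - P₁)`, where `Pₖ` is the orthogonal
projection onto the closed subspace `Mₖ`. -/
noncomputable def drOperator (M₁ M₂ : ClosedSubmodule ℂ X) : X →L[ℂ] X :=
  M₂.toSubmodule.starProjection * M₁.toSubmodule.starProjection +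
    (1 - M₂.toSubmodule.starProjection) * (1 - M₁.toSubmodule.starProjection)

/-- The subspace `(M₁ ∩ M₂) ⊕ (M₁ᗮ ∩ M₂ᗮ)`, as an algebraic sum of subspaces
(the sum is orthogonal by `isOrtho_summands`, and closed). -/
noncomputable def limitSpace (M₁ M₂ : ClosedSubmodule ℂ X) : Submodule ℂ X :=
  (M₁.toSubmodule ⊓ M₂.toSubmodule) ⊔ (M₁.toSubmoduleᗮ ⊓ M₂.toSubmoduleᗮ)

theorem isOrtho_summands (M₁ M₂ : ClosedSubmodule ℂ X) :
    (M₁.toSubmodule ⊓ M₂.toSubmodule) ⟂ (M₁.toSubmoduleᗮ ⊓ M₂.toSubmoduleᗮ) :=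
  (Submodule.isOrtho_orthogonal_right M₁.toSubmodule).mono inf_le_left inf_le_left

instance limitSpace_hasOrthogonalProjection (M₁ M₂ : ClosedSubmodule ℂ X) :
    (limitSpace M₁ M₂).HasOrthogonalProjection := by
  have hA : IsClosed ((M₁.toSubmodule ⊓ M₂.toSubmodule : Submodule ℂ X) : Set X) :=
    M₁.isClosed.inter M₂.isClosed
  have hB : IsClosed ((M₁.toSubmoduleᗮ ⊓ M₂.toSubmoduleᗮ : Submodule ℂ X) : Set X) :=
    (Submodule.isClosed_orthogonal _).inter (Submodule.isClosed_orthogonal _)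
  have hAB := isOrtho_summands M₁ M₂
  unfold limitSpace
  generalize (M₁.toSubmodule ⊓ M₂.toSubmodule : Submodule ℂ X) = A at *
  generalize (M₁.toSubmoduleᗮ ⊓ M₂.toSubmoduleᗮ : Submodule ℂ X) = B at *
  have := hA.completeSpace_coe
  have := hB.completeSpace_coe
  refine ⟨fun v => ⟨A.starProjection v + B.starProjection v,
    Submodule.add_mem_sup (A.starProjection_apply_mem v) (B.starProjection_apply_mem v), ?_⟩⟩
  rw [← Submodule.inf_orthogonal]
  refine ⟨?_, ?_⟩
  · rw [← sub_sub]
    exact Submodule.sub_mem _ (A.sub_starProjection_mem_orthogonal v)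
      (hAB.symm (B.starProjection_apply_mem v))
  · rw [add_comm, ← sub_sub]
    exact Submodule.sub_mem _ (B.sub_starProjection_mem_orthogonal v)
      (hAB (A.starProjection_apply_mem v))

/-- The orthogonal projection `P` onto `(M₁ ∩ M₂) ⊕ (M₁ᗮ ∩ M₂ᗮ)`. -/
noncomputable def limitProjection (M₁ M₂ : ClosedSubmodule ℂ X) : X →L[ℂ] X :=
  (limitSpace M₁ M₂).starProjection

end DouglasRachford

/-!
Write `B = (P₁ - P₂)²` (`gapOperator`). The operator `T` is normal, commutes with `B`, and satisfies
`T* T = T T* = 1 - B` and `(1 - T)* (1 - T) = B`, while the kernel of `B` is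
`(M₁ ∩ M₂) ⊕ (M₁ᗮ ∩ M₂ᗮ)`. Hence `‖T x‖² = ‖x‖² - ⟪x, B x⟫` and `‖x - T x‖² = ⟪x, B x⟫`, and the
speed of convergence on the orthogonal complement of the kernel is governed by the spectrum of the
positive operator `B` near `0`, which is accessed through the continuous functional calculus: for
`f` supported in `[δ, ε]`, the quadratic form of `B` lies between `δ` and `ε` on unit vectors in the
range of `f(B)` (`le_re_inner_cfc`, `re_inner_cfc_le`).

* Vectors in the range of `f(B)` with `f` supported in `[δ, ∞)`, `δ > 0`, converge geometrically.
  Together with the kernel of `B` they span a dense subspace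
  (`dense_superpolynomialSubmodule`), and as `‖T ^ n - P‖ ≤ 1` this gives strong convergence.
* The sum `M₁ + M₂` is closed if and only if `B` is bounded below on the orthogonal complement of
  its kernel (`exists_le_re_inner_gapOperator`, `isClosed_sup_of_le_re_inner_gapOperator`), by the
  open mapping theorem. A lower bound for `B` gives a uniform geometric rate.
* If `M₁ + M₂` is not closed, then `0` is an accumulation point of the spectrum of `B`. This yields
  unit vectors `y k` with disjoint spectral supports approaching `0`, hence with orthogonal orbits,
  such that `T ^ n (y k)` stays near `y k` for `n ≤ N k` and is negligible for `n ≥ N (k + 1)`. For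
  `x = ∑ 0.9 ^ k • y k` only the diagonal terms `0.81 ^ k * ⟪y k, T ^ n (y k)⟫` contribute to
  `⟪x, T ^ n x⟫`. At times between `N k` and `N (k + 1)` the `k`-th term may be negative, but the
  tail of the geometric series outweighs it, so that `Re ⟪x, T ^ n x⟫ ≥ 0.81 ^ k / 2`
  (`exists_weak_orbit_ge`). As `N k` can grow as fast as desired, this dominates any given null
  sequence. Weak arbitrary slowness implies arbitrary slowness.
-/

namespace DouglasRachford

/-! ### Modes of convergence -/

section Modes

variable {X : Type*} [NormedAddCommGroup X] [NormedSpace ℂ X]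

theorem WeaklyArbitrarilySlow.arbitrarilySlow {S : ℕ → X →L[ℂ] X} (h : WeaklyArbitrarilySlow S) :
    ArbitrarilySlow S := by
  intro r hr0 hr
  obtain ⟨x, φ, hx⟩ := h r hr0 hr
  refine ⟨((‖φ‖ : ℝ) : ℂ) • x, fun n => (hx n).trans ?_⟩
  rw [map_smul, norm_smul, Complex.norm_real, norm_norm]
  exact (Complex.re_le_norm _).trans (φ.le_opNorm _)

/-- The subspace of the vectors for which the convergence is superpolynomially fast. -/
def superpolynomialSubmodule (S : ℕ → X →L[ℂ] X) : Submodule ℂ X where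
  carrier := {x | SuperpolynomiallyFast S x}
  zero_mem' k _ := by simp
  add_mem' {x y} hx hy k hk := by
    refine IsBigO.trans_isLittleO (g := fun n => ‖S n x‖ + ‖S n y‖) ?_ ((hx k hk).add (hy k hk))
    refine IsBigO.of_bound 1 (Eventually.of_forall fun n => ?_)
    rw [one_mul, norm_norm, map_add, Real.norm_of_nonneg (by positivity)]
    exact norm_add_le _ _
  smul_mem' c x hx k hk := by
    simpa only [map_smul, norm_smul] using (hx k hk).const_mul_left ‖c‖

theorem superpolynomiallyFast_of_geometric {S : ℕ → X →L[ℂ] X} {x : X} {q C : ℝ} (hq0 : 0 ≤ q)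
    (hq : q < 1) (h : ∀ n, ‖S n x‖ ≤ q ^ n * C) : SuperpolynomiallyFast S x := by
  intro k _
  have h1 : (fun n => ‖S n x‖) =O[atTop] fun n : ℕ => q ^ n := by
    refine IsBigO.of_bound C (Eventually.of_forall fun n => ?_)
    rw [norm_norm, Real.norm_of_nonneg (by positivity), mul_comm]
    exact h n
  refine h1.trans_isLittleO ?_
  rw [isLittleO_iff_tendsto']
  · have := tendsto_pow_const_mul_const_pow_of_lt_one k hq0 hq
    refine this.congr fun n => ?_
    rw [div_inv_eq_mul, mul_comm]
  · filter_upwards [eventually_gt_atTop 0] with n hn h0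
    exact absurd h0 (by positivity)

theorem tendsto_of_superpolynomiallyFast {S : ℕ → X →L[ℂ] X} {x : X}
    (h : SuperpolynomiallyFast S x) : Tendsto (fun n => S n x) atTop (𝓝 0) := by
  rw [tendsto_zero_iff_norm_tendsto_zero]
  refine (h 1 le_rfl).trans_tendsto ?_
  simpa using tendsto_inv_atTop_nhds_zero_nat (𝕜 := ℝ)

end Modes

variable {X : Type*} [NormedAddCommGroup X] [InnerProductSpace ℂ X] [CompleteSpace X]

/-! ### Spectral localisation for a positive operator -/

theorem re_inner_cfc_nonneg {B : X →L[ℂ] X} (hB : 0 ≤ B) {f g : ℝ → ℝ} (hf : Continuous f)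
    (hg : Continuous g) (h : ∀ t ∈ spectrum ℝ B, 0 ≤ g t * f t ^ 2) (z : X) :
    0 ≤ (inner ℂ (cfc f B z) (cfc g B (cfc f B z))).re := by
  have hsa : IsSelfAdjoint B := hB.isSelfAdjoint
  have h1 : cfc f B * (cfc g B * cfc f B) = cfc (fun t => g t * f t ^ 2) B := by
    rw [← cfc_mul g f B hg.continuousOn hf.continuousOn,
      ← cfc_mul f (fun t => g t * f t) B hf.continuousOn (hg.mul hf).continuousOn]
    congr 1; ext t; ring
  have h2 : 0 ≤ cfc (fun t => g t * f t ^ 2) B := cfc_nonneg h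
  rw [← h1, ContinuousLinearMap.nonneg_iff_isPositive] at h2
  have h3 := h2.re_inner_nonneg_right z
  have h4 : IsSelfAdjoint (cfc f B) := cfc_predicate f B
  have h5 := (ContinuousLinearMap.isSelfAdjoint_iff_isSymmetric.mp h4) z (cfc g B (cfc f B z))
  simp only [ContinuousLinearMap.coe_coe] at h5
  rw [h5]
  simpa using h3

/-- The quadratic form of `B` is at least `δ` on vectors spectrally supported in `[δ, ∞)`. -/
theorem le_re_inner_cfc {B : X →L[ℂ] X} (hB : 0 ≤ B) {f : ℝ → ℝ} (hf : Continuous f) {δ : ℝ}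
    (h : ∀ t ∈ spectrum ℝ B, t < δ → f t = 0) (z : X) :
    δ * ‖cfc f B z‖ ^ 2 ≤ (inner ℂ (cfc f B z) (B (cfc f B z))).re := by
  have hsa : IsSelfAdjoint B := hB.isSelfAdjoint
  have h1 := re_inner_cfc_nonneg hB hf (g := fun t => t - δ) (by fun_prop) (fun t hs => by
    rcases lt_or_ge t δ with ht | ht
    · simp [h t hs ht]
    · exact mul_nonneg (by linarith) (sq_nonneg _)) z
  have h2 : cfc (fun t : ℝ => t - δ) B = B - algebraMap ℝ (X →L[ℂ] X) δ := by
    rw [cfc_sub (fun t : ℝ => t) (fun _ => δ) B, cfc_id' ℝ B, cfc_const δ B]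
  rw [h2, sub_apply, inner_sub_right, Algebra.algebraMap_eq_smul_one,
    smul_apply, one_apply_eq_self,
    inner_smul_right_eq_smul, Complex.sub_re, Complex.smul_re, ← RCLike.re_eq_complex_re,
    inner_self_eq_norm_sq] at h1
  simpa using h1

/-- The quadratic form of `B` is at most `ε` on vectors spectrally supported in `(-∞, ε]`. -/
theorem re_inner_cfc_le {B : X →L[ℂ] X} (hB : 0 ≤ B) {f : ℝ → ℝ} (hf : Continuous f) {ε : ℝ}
    (h : ∀ t ∈ spectrum ℝ B, ε < t → f t = 0) (z : X) :
    (inner ℂ (cfc f B z) (B (cfc f B z))).re ≤ ε * ‖cfc f B z‖ ^ 2 := by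
  have hsa : IsSelfAdjoint B := hB.isSelfAdjoint
  have h1 := re_inner_cfc_nonneg hB hf (g := fun t => ε - t) (by fun_prop) (fun t hs => by
    rcases lt_or_ge ε t with ht | ht
    · simp [h t hs ht]
    · exact mul_nonneg (by linarith) (sq_nonneg _)) z
  have h2 : cfc (fun t : ℝ => ε - t) B = algebraMap ℝ (X →L[ℂ] X) ε - B := by
    rw [cfc_sub (fun _ => ε) (fun t : ℝ => t) B, cfc_id' ℝ B, cfc_const ε B]
  rw [h2, sub_apply, inner_sub_right, Algebra.algebraMap_eq_smul_one,
    smul_apply, one_apply_eq_self,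
    inner_smul_right_eq_smul, Complex.sub_re, Complex.smul_re, ← RCLike.re_eq_complex_re,
    inner_self_eq_norm_sq] at h1
  simpa using h1

/-- The soft threshold `t ↦ max (t - δ) 0`: a continuous function vanishing on `(-∞, δ]` which is
uniformly close to the identity on `[0, ∞)` when `δ` is small. -/
def threshold (δ t : ℝ) : ℝ := max (t - δ) 0

/-- The tent `t ↦ max (ε - t) 0`, positive exactly on `(-∞, ε)`. -/
def tent (ε t : ℝ) : ℝ := max (ε - t) 0

@[fun_prop]
theorem continuous_threshold (δ : ℝ) : Continuous (threshold δ) := by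
  unfold threshold; fun_prop

@[fun_prop]
theorem continuous_tent (ε : ℝ) : Continuous (tent ε) := by
  unfold tent; fun_prop

theorem threshold_of_le {δ t : ℝ} (h : t ≤ δ) : threshold δ t = 0 := by
  simp [threshold, h]

theorem tent_of_le {ε t : ℝ} (h : ε ≤ t) : tent ε t = 0 := by
  simp [tent, h]

theorem norm_cfc_threshold_sub_le {B : X →L[ℂ] X} (hB : 0 ≤ B) {δ : ℝ} (hδ : 0 ≤ δ) :
    ‖cfc (threshold δ) B - B‖ ≤ δ := by
  have hsa : IsSelfAdjoint B := hB.isSelfAdjoint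
  have h : cfc (threshold δ) B - B = cfc (fun t => threshold δ t - t) B := by
    rw [cfc_sub (threshold δ) (fun t : ℝ => t) B (continuous_threshold δ).continuousOn, cfc_id' ℝ B]
  rw [h]
  refine norm_cfc_le hδ fun t ht => ?_
  have h0 : 0 ≤ t := spectrum_nonneg_of_nonneg hB ht
  rw [Real.norm_eq_abs, abs_le, threshold]
  rcases le_total t δ with h | h
  · rw [max_eq_right (by linarith)]; constructor <;> linarith
  · rw [max_eq_left (by linarith)]; constructor <;> linarith

theorem tendsto_cfc_threshold {B : X →L[ℂ] X} (hB : 0 ≤ B) (z : X) :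
    Tendsto (fun δ : ℝ => cfc (threshold δ) B z) (𝓝[>] 0) (𝓝 (B z)) := by
  rw [tendsto_iff_norm_sub_tendsto_zero]
  have h1 : Tendsto (fun δ : ℝ => δ * ‖z‖) (𝓝[>] 0) (𝓝 0) := by
    have : Tendsto (fun δ : ℝ => δ * ‖z‖) (𝓝 0) (𝓝 (0 * ‖z‖)) :=
      (continuous_id.mul continuous_const).tendsto 0
    rw [zero_mul] at this
    exact this.mono_left nhdsWithin_le_nhds
  refine squeeze_zero' (Eventually.of_forall fun _ => norm_nonneg _) ?_ h1
  filter_upwards [self_mem_nhdsWithin] with δ hδ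
  rw [← sub_apply]
  exact (ContinuousLinearMap.le_opNorm _ _).trans
    (mul_le_mul_of_nonneg_right (norm_cfc_threshold_sub_le hB (le_of_lt hδ)) (norm_nonneg _))

/-- A vector spectrally supported away from `0` is orthogonal to the kernel. -/
theorem inner_cfc_eq_zero_of_ker {B : X →L[ℂ] X} (hB : 0 ≤ B) {f : ℝ → ℝ} (hf : Continuous f)
    {δ : ℝ} (hδ : 0 < δ) (h : ∀ t ∈ spectrum ℝ B, t < δ → f t = 0) (z : X) {v : X} (hv : B v = 0) :
    inner ℂ (cfc f B z) v = 0 := by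
  have hsa : IsSelfAdjoint B := hB.isSelfAdjoint
  have h4 : IsSelfAdjoint (cfc f B) := cfc_predicate f B
  have h5 := (ContinuousLinearMap.isSelfAdjoint_iff_isSymmetric.mp h4) z v
  simp only [ContinuousLinearMap.coe_coe] at h5
  have hc : Commute (cfc f B) B := hsa.commute_cfc (Commute.refl B) f
  have h6 : B (cfc f B v) = 0 := by
    have := congrArg (fun S : X →L[ℂ] X => S v) hc.eq
    simp only [mul_apply_eq_comp, hv, map_zero] at this
    exact this.symm
  have h7 := le_re_inner_cfc hB hf h v
  rw [h6, inner_zero_right, Complex.zero_re] at h7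
  have h8 : ‖cfc f B v‖ ^ 2 = 0 := le_antisymm (by nlinarith) (sq_nonneg _)
  have h9 : cfc f B v = 0 := by simpa using h8
  rw [h5, h9, inner_zero_right]

theorem inner_cfc_cfc_eq_zero {B S : X →L[ℂ] X} (hB : 0 ≤ B) (hS : Commute B S) {f g : ℝ → ℝ}
    (hf : Continuous f) (hg : Continuous g) (h : ∀ t, f t * g t = 0) (z w : X) :
    inner ℂ (cfc f B z) (S (cfc g B w)) = 0 := by
  have hsa : IsSelfAdjoint B := hB.isSelfAdjoint
  have h4 : IsSelfAdjoint (cfc f B) := cfc_predicate f B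
  have h5 := (ContinuousLinearMap.isSelfAdjoint_iff_isSymmetric.mp h4) z (S (cfc g B w))
  simp only [ContinuousLinearMap.coe_coe] at h5
  have hc : Commute (cfc f B) S := hsa.commute_cfc hS f
  have h1 : cfc f B * cfc g B = 0 := by
    rw [← cfc_mul f g B hf.continuousOn hg.continuousOn]
    simp only [h]
    exact cfc_const_zero ℝ B
  have h2 : cfc f B * S * cfc g B = 0 := by rw [hc.eq, mul_assoc, h1, mul_zero]
  rw [h5]
  have := congrArg (fun R : X →L[ℂ] X => R w) h2
  simp only [mul_apply_eq_comp, zero_apply] at this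
  rw [this, inner_zero_right]

/-- If the spectrum of `B` does not meet `(0, ε)`, then `B ≥ ε` on the orthogonal complement of its
kernel. -/
theorem le_re_inner_of_spectral_gap {B : X →L[ℂ] X} (hB : 0 ≤ B) {ε : ℝ}
    (h : ∀ t ∈ spectrum ℝ B, 0 < t → ε ≤ t) {x : X} (hx : x ∈ B.kerᗮ) :
    ε * ‖x‖ ^ 2 ≤ (inner ℂ x (B x)).re := by
  have hsa : IsSelfAdjoint B := hB.isSelfAdjoint
  have hclosed : IsClosed {x : X | ε * ‖x‖ ^ 2 ≤ (inner ℂ x (B x)).re} :=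
    isClosed_le (by fun_prop) (by fun_prop)
  have hrange : ∀ z, B z ∈ {x : X | ε * ‖x‖ ^ 2 ≤ (inner ℂ x (B x)).re} := fun z => by
    refine hclosed.mem_of_tendsto (tendsto_cfc_threshold hB z) ?_
    filter_upwards [self_mem_nhdsWithin] with δ (hδ : 0 < δ)
    refine le_re_inner_cfc hB (continuous_threshold δ) (fun t ht htε => ?_) z
    rcases lt_or_ge 0 t with h0 | h0
    · exact absurd (h t ht h0) (not_le.mpr htε)
    · exact threshold_of_le (h0.trans hδ.le)
  rw [ContinuousLinearMap.orthogonal_ker, (ContinuousLinearMap.isSelfAdjoint_iff'.mp hsa)] at hx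
  exact closure_minimal (by rintro _ ⟨z, rfl⟩; exact hrange z) hclosed hx

/-- If the spectrum of `B` has a point in `(0, ε)`, then some unit vector is spectrally supported
in a compact subset of `(0, ε)`. -/
theorem exists_unit_cfc_of_mem_spectrum {B : X →L[ℂ] X} (hB : 0 ≤ B) {ε t : ℝ}
    (ht : t ∈ spectrum ℝ B) (h0 : 0 < t) (htε : t < ε) :
    ∃ z, ‖cfc (fun s => threshold (t / 2) s * tent ε s) B z‖ = 1 := by
  have hsa : IsSelfAdjoint B := hB.isSelfAdjoint
  have hne : cfc (fun s => threshold (t / 2) s * tent ε s) B ≠ 0 := fun h => by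
    rw [← cfc_const_zero ℝ B, cfc_eq_cfc_iff_eqOn] at h
    have h1 := h ht
    simp only [threshold, tent] at h1
    rw [max_eq_left (by linarith), max_eq_left (by linarith)] at h1
    exact (mul_pos (by linarith : 0 < t - t / 2) (by linarith : 0 < ε - t)).ne' h1
  obtain ⟨z, hz⟩ := ContinuousLinearMap.exists_ne_zero hne
  refine ⟨((‖cfc (fun s => threshold (t / 2) s * tent ε s) B z‖⁻¹ : ℝ) : ℂ) • z, ?_⟩
  rw [map_smul, norm_smul, Complex.norm_real, norm_inv, norm_norm,
    inv_mul_cancel₀ (norm_ne_zero_iff.mpr hz)]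

/-! ### Slow weak orbits from almost invariant vectors -/

/-- The geometric weights `0.81 ^ j` decay so slowly that the tail beyond `k`, weighted by `1 / 2`,
outweighs the term with index `k` and small negative contributions of the earlier terms. -/
theorem le_tsum_weighted {m : ℕ → ℝ} {k : ℕ} (h1 : ∀ j < k, -((81 / 100) ^ k / 10) ≤ m j)
    (h2 : -1 ≤ m k) (h3 : ∀ j, k < j → 1 / 2 ≤ m j)
    (hs : Summable fun j => (81 / 100 : ℝ) ^ j * m j) :
    (81 / 100 : ℝ) ^ k / 2 ≤ ∑' j, (81 / 100 : ℝ) ^ j * m j := by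
  have hgeo : HasSum (fun j => (81 / 100 : ℝ) ^ j) (100 / 19) := by
    have := hasSum_geometric_of_lt_one (r := (81 / 100 : ℝ)) (by norm_num) (by norm_num)
    norm_num at this ⊢
    exact this
  have hpos : ∀ j, 0 < (81 / 100 : ℝ) ^ j := fun j => by positivity
  rw [← hs.sum_add_tsum_nat_add (k + 1), Finset.sum_range_succ]
  have ha : -((81 / 100 : ℝ) ^ k / 10 * (100 / 19)) ≤
      ∑ j ∈ Finset.range k, (81 / 100 : ℝ) ^ j * m j := by
    have h4 : ∑ j ∈ Finset.range k, (81 / 100 : ℝ) ^ j ≤ 100 / 19 :=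
      sum_le_hasSum _ (fun j _ => (hpos j).le) hgeo
    calc -((81 / 100 : ℝ) ^ k / 10 * (100 / 19))
        ≤ -((81 / 100 : ℝ) ^ k / 10) * ∑ j ∈ Finset.range k, (81 / 100 : ℝ) ^ j := by
          nlinarith [hpos k]
      _ = ∑ j ∈ Finset.range k, (81 / 100 : ℝ) ^ j * -((81 / 100 : ℝ) ^ k / 10) := by
          rw [Finset.mul_sum]; exact Finset.sum_congr rfl fun _ _ => mul_comm _ _
      _ ≤ _ := Finset.sum_le_sum fun j hj =>
          mul_le_mul_of_nonneg_left (h1 j (Finset.mem_range.mp hj)) (hpos j).le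
  have hb : (81 / 100 : ℝ) ^ k * -1 ≤ (81 / 100 : ℝ) ^ k * m k :=
    mul_le_mul_of_nonneg_left h2 (hpos k).le
  have hc : (100 / 19 : ℝ) * ((81 / 100 : ℝ) ^ (k + 1) * (1 / 2)) ≤
      ∑' j, (81 / 100 : ℝ) ^ (j + (k + 1)) * m (j + (k + 1)) := by
    refine hasSum_le (f := fun j => (81 / 100 : ℝ) ^ j * ((81 / 100 : ℝ) ^ (k + 1) * (1 / 2)))
      (fun j => ?_) (hgeo.mul_right ((81 / 100 : ℝ) ^ (k + 1) * (1 / 2)))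
      ((summable_nat_add_iff (k + 1)).mpr hs).hasSum
    rw [pow_add _ j, ← mul_assoc]
    exact mul_le_mul_of_nonneg_left (h3 _ (by omega)) (by positivity)
  rw [pow_succ] at hc
  linarith [hpos k]

/-- Suppose that the unit vectors `y k` have mutually orthogonal orbits, that the orbit of `y k`
stays near `y k` up to time `N k`, and that the orbits of `y j`, `j < k`, are small from time `N k`
on. Then the vector `∑ 0.9 ^ k • y k` has a slow weak orbit: for `N k ≤ n < N (k + 1)` the terms
with index beyond `k` are still near their starting point and outweigh the rest. -/
theorem exists_weak_orbit_ge {S : ℕ → X →L[ℂ] X} {y : ℕ → X} {N : ℕ → ℕ} {r : ℕ → ℝ} {C : ℝ}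
    (hC : 0 ≤ C) (hy : ∀ k, ‖y k‖ = 1) (hS : ∀ n k, ‖S n (y k)‖ ≤ 1)
    (horth : ∀ n j k, j ≠ k → inner ℂ (y j) (S n (y k)) = 0)
    (hN0 : N 0 = 0) (hN : StrictMono N)
    (hnear : ∀ k n, n ≤ N k → 1 / 2 ≤ (inner ℂ (y k) (S n (y k))).re)
    (hfar : ∀ j k n, j < k → N k ≤ n → ‖S n (y j)‖ ≤ (81 / 100) ^ k / 10)
    (hr : ∀ k n, N k ≤ n → r n ≤ C * ((81 / 100) ^ k / 2)) :
    ∃ (x : X) (φ : X →L[ℂ] ℂ), ∀ n, r n ≤ (φ (S n x)).re := by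
  have hgeo : Summable fun k => (9 / 10 : ℝ) ^ k :=
    summable_geometric_of_lt_one (by norm_num) (by norm_num)
  have hsum : Summable fun k => (9 / 10 : ℂ) ^ k • y k := by
    refine Summable.of_norm_bounded hgeo fun k => ?_
    rw [norm_smul, hy, mul_one, norm_pow]
    norm_num
  obtain ⟨x, hx⟩ := hsum
  refine ⟨x, (C : ℂ) • innerSL ℂ x, fun n => ?_⟩
  -- only the diagonal terms survive in the double series for `⟪x, S n x⟫`
  have hcoef : ∀ k, inner ℂ x (S n (y k)) = (9 / 10 : ℂ) ^ k * inner ℂ (y k) (S n (y k)) := by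
    intro k
    have h1 : HasSum (fun j => inner ℂ (S n (y k)) ((9 / 10 : ℂ) ^ j • y j))
        (inner ℂ (S n (y k)) x) := (innerSL ℂ (S n (y k))).hasSum hx
    have h2 := h1.unique (hasSum_single k fun j hj => by
      rw [inner_smul_right, inner_eq_zero_symm.mp (horth n j k hj), mul_zero])
    rw [← inner_conj_symm, h2, inner_smul_right, map_mul, inner_conj_symm, map_pow, map_div₀,
      map_ofNat, map_ofNat]
  have hdiag : HasSum (fun k => (81 / 100 : ℝ) ^ k * (inner ℂ (y k) (S n (y k))).re)
      (inner ℂ x (S n x)).re := by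
    have h1 : HasSum (fun k => inner ℂ x (S n ((9 / 10 : ℂ) ^ k • y k))) (inner ℂ x (S n x)) :=
      ((innerSL ℂ x).comp (S n)).hasSum hx
    have h2 := Complex.hasSum_re h1
    convert h2 using 2 with k
    have h3 : (9 / 10 : ℂ) ^ k * (9 / 10 : ℂ) ^ k = (((81 / 100 : ℝ) ^ k : ℝ) : ℂ) := by
      rw [← mul_pow]; push_cast; norm_num
    rw [map_smul, inner_smul_right, hcoef, ← mul_assoc, h3, Complex.re_ofReal_mul]
  have habs : ∀ k, |(inner ℂ (y k) (S n (y k))).re| ≤ ‖S n (y k)‖ := fun k => by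
    refine (Complex.abs_re_le_norm _).trans ((norm_inner_le_norm _ _).trans ?_)
    rw [hy, one_mul]
  obtain ⟨k, hk1, hk2⟩ : ∃ k, N k ≤ n ∧ n < N (k + 1) := by
    have hex : ∃ k, n < N (k + 1) := ⟨n, (Nat.lt_succ_self n).trans_le (hN.le_apply)⟩
    classical
    refine ⟨Nat.find hex, ?_, Nat.find_spec hex⟩
    rcases hk : Nat.find hex with _ | k
    · rw [hN0]; exact Nat.zero_le _
    · exact not_lt.mp (Nat.find_min hex (by omega))
  have hmain := le_tsum_weighted (k := k) (m := fun j => (inner ℂ (y j) (S n (y j))).re)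
    (fun j hj => (abs_le.mp ((habs j).trans (hfar j k n hj hk1))).1)
    (abs_le.mp ((habs k).trans (hS n k))).1
    (fun j hj => hnear j n (hk2.le.trans (hN.monotone (by omega)))) hdiag.summable
  rw [hdiag.tsum_eq] at hmain
  calc r n ≤ C * ((81 / 100) ^ k / 2) := hr k n hk1
    _ ≤ C * (inner ℂ x (S n x)).re := mul_le_mul_of_nonneg_left hmain hC
    _ = _ := by simp

variable (M₁ M₂ : ClosedSubmodule ℂ X)

/-! ### Algebra of the Douglas–Rachford operator -/

/-- The difference `P₁ - P₂` of the two projections. -/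
noncomputable def projDiff (M₁ M₂ : ClosedSubmodule ℂ X) : X →L[ℂ] X :=
  M₁.toSubmodule.starProjection - M₂.toSubmodule.starProjection

/-- The positive operator `(P₁ - P₂)²`; it commutes with `T` and controls `|T|² = 1 - (P₁ - P₂)²`. -/
noncomputable def gapOperator (M₁ M₂ : ClosedSubmodule ℂ X) : X →L[ℂ] X :=
  projDiff M₁ M₂ * projDiff M₁ M₂

theorem isSelfAdjoint_projDiff : IsSelfAdjoint (projDiff M₁ M₂) :=
  (isSelfAdjoint_starProjection _).sub (isSelfAdjoint_starProjection _)

theorem gapOperator_nonneg : 0 ≤ gapOperator M₁ M₂ := by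
  have h := star_mul_self_nonneg (projDiff M₁ M₂)
  rwa [(isSelfAdjoint_projDiff M₁ M₂).star_eq] at h

theorem star_drOperator : star (drOperator M₁ M₂) = drOperator M₂ M₁ := by
  have h1 := (isSelfAdjoint_starProjection M₁.toSubmodule).star_eq
  have h2 := (isSelfAdjoint_starProjection M₂.toSubmodule).star_eq
  simp [drOperator, h1, h2]

theorem drOperator_mul_swap :
    drOperator M₂ M₁ * drOperator M₁ M₂ = 1 - gapOperator M₁ M₂ := by
  have h1 : M₁.toSubmodule.starProjection * M₁.toSubmodule.starProjection = _ :=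
    M₁.toSubmodule.isIdempotentElem_starProjection
  have h2 : M₂.toSubmodule.starProjection * M₂.toSubmodule.starProjection = _ :=
    M₂.toSubmodule.isIdempotentElem_starProjection
  unfold gapOperator projDiff drOperator
  generalize M₁.toSubmodule.starProjection = p at *
  generalize M₂.toSubmodule.starProjection = q at *
  have h3 : ∀ a, q * (q * a) = q * a := fun a => by rw [← mul_assoc, h2]
  simp only [mul_add, add_mul, mul_sub, sub_mul, mul_assoc, h1, h2, h3, one_mul, mul_one]
  abel

theorem gapOperator_swap : gapOperator M₂ M₁ = gapOperator M₁ M₂ := by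
  unfold gapOperator projDiff
  noncomm_ring

theorem drOperator_add_swap :
    drOperator M₁ M₂ + drOperator M₂ M₁ = 2 - 2 * gapOperator M₁ M₂ := by
  have h1 : M₁.toSubmodule.starProjection * M₁.toSubmodule.starProjection = _ :=
    M₁.toSubmodule.isIdempotentElem_starProjection
  have h2 : M₂.toSubmodule.starProjection * M₂.toSubmodule.starProjection = _ :=
    M₂.toSubmodule.isIdempotentElem_starProjection
  unfold gapOperator projDiff drOperator
  generalize M₁.toSubmodule.starProjection = p at *
  generalize M₂.toSubmodule.starProjection = q at *
  rw [two_mul, ← one_add_one_eq_two]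
  simp only [mul_sub, sub_mul, h1, h2, one_mul, mul_one]
  abel

theorem one_sub_mul_one_sub_swap :
    (1 - drOperator M₂ M₁) * (1 - drOperator M₁ M₂) = gapOperator M₁ M₂ := by
  have h1 := drOperator_mul_swap M₁ M₂
  have h2 := drOperator_add_swap M₁ M₂
  calc _ = 1 - (drOperator M₁ M₂ + drOperator M₂ M₁) + drOperator M₂ M₁ * drOperator M₁ M₂ := by
        noncomm_ring
    _ = _ := by rw [h1, h2, two_mul, ← one_add_one_eq_two]; abel

theorem commute_gapOperator_drOperator : Commute (gapOperator M₁ M₂) (drOperator M₁ M₂) := by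
  have h1 := drOperator_mul_swap M₁ M₂
  have h2 := drOperator_mul_swap M₂ M₁
  rw [gapOperator_swap] at h2
  have h3 : gapOperator M₁ M₂ = 1 - drOperator M₂ M₁ * drOperator M₁ M₂ := by rw [h1]; abel
  change _ * _ = _ * _
  calc gapOperator M₁ M₂ * drOperator M₁ M₂
      = (1 - drOperator M₁ M₂ * drOperator M₂ M₁) * drOperator M₁ M₂ := by rw [h2]; noncomm_ring
    _ = drOperator M₁ M₂ * (1 - drOperator M₂ M₁ * drOperator M₁ M₂) := by noncomm_ring
    _ = _ := by rw [← h3]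

theorem norm_sq_eq_re_inner {S R : X →L[ℂ] X} (h : star S * S = R) (x : X) :
    ‖S x‖ ^ 2 = (inner ℂ x (R x)).re := by
  have h1 : inner ℂ x (R x) = inner ℂ (S x) (S x) := by
    rw [← h, mul_apply_eq_comp, ContinuousLinearMap.star_eq_adjoint,
      ContinuousLinearMap.adjoint_inner_right]
  rw [h1, ← RCLike.re_eq_complex_re, inner_self_eq_norm_sq]

theorem norm_projDiff_sq (x : X) :
    ‖projDiff M₁ M₂ x‖ ^ 2 = (inner ℂ x (gapOperator M₁ M₂ x)).re :=
  norm_sq_eq_re_inner (by rw [(isSelfAdjoint_projDiff M₁ M₂).star_eq]; rfl) x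

theorem norm_sub_drOperator_sq (x : X) :
    ‖x - drOperator M₁ M₂ x‖ ^ 2 = (inner ℂ x (gapOperator M₁ M₂ x)).re := by
  have := norm_sq_eq_re_inner (S := 1 - drOperator M₁ M₂) (R := gapOperator M₁ M₂)
    (by rw [star_sub, star_one, star_drOperator, one_sub_mul_one_sub_swap]) x
  simpa using this

theorem norm_drOperator_sq (x : X) :
    ‖drOperator M₁ M₂ x‖ ^ 2 = ‖x‖ ^ 2 - (inner ℂ x (gapOperator M₁ M₂ x)).re := by
  have := norm_sq_eq_re_inner (S := drOperator M₁ M₂) (R := 1 - gapOperator M₁ M₂)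
    (by rw [star_drOperator, drOperator_mul_swap]) x
  rw [this, sub_apply, one_apply_eq_self, inner_sub_right, Complex.sub_re,
    ← RCLike.re_eq_complex_re, inner_self_eq_norm_sq]

theorem norm_drOperator_apply_le (x : X) : ‖drOperator M₁ M₂ x‖ ≤ ‖x‖ := by
  have h1 := norm_drOperator_sq M₁ M₂ x
  have h2 := norm_projDiff_sq M₁ M₂ x
  exact (sq_le_sq₀ (norm_nonneg _) (norm_nonneg _)).mp (by nlinarith [sq_nonneg ‖projDiff M₁ M₂ x‖])

theorem norm_drOperator_pow_apply_le (n : ℕ) (x : X) : ‖(drOperator M₁ M₂ ^ n) x‖ ≤ ‖x‖ := by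
  induction n with
  | zero => simp
  | succ n ih =>
    rw [pow_succ', mul_apply_eq_comp]
    exact (norm_drOperator_apply_le M₁ M₂ _).trans ih

theorem gapOperator_apply_eq_zero_iff {x : X} :
    gapOperator M₁ M₂ x = 0 ↔ x ∈ limitSpace M₁ M₂ := by
  constructor
  · intro h
    have h1 := norm_projDiff_sq M₁ M₂ x
    rw [h, inner_zero_right, Complex.zero_re, sq_eq_zero_iff, norm_eq_zero] at h1
    have h2 : M₁.toSubmodule.starProjection x = M₂.toSubmodule.starProjection x :=
      sub_eq_zero.mp h1
    rw [limitSpace, ← add_sub_cancel (M₁.toSubmodule.starProjection x) x]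
    refine Submodule.add_mem_sup ⟨Submodule.starProjection_apply_mem _ _, ?_⟩
      ⟨Submodule.sub_starProjection_mem_orthogonal _, ?_⟩
    · rw [h2]; exact Submodule.starProjection_apply_mem _ _
    · rw [h2]; exact Submodule.sub_starProjection_mem_orthogonal _
  · intro h
    obtain ⟨u, hu, v, hv, rfl⟩ := Submodule.mem_sup.mp h
    have h1 : M₁.toSubmodule.starProjection u = u := Submodule.starProjection_eq_self_iff.mpr hu.1
    have h2 : M₂.toSubmodule.starProjection u = u := Submodule.starProjection_eq_self_iff.mpr hu.2
    have h3 : M₁.toSubmodule.starProjection v = 0 := by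
      rw [Submodule.starProjection_apply_eq_zero_iff]; exact hv.1
    have h4 : M₂.toSubmodule.starProjection v = 0 := by
      rw [Submodule.starProjection_apply_eq_zero_iff]; exact hv.2
    simp [gapOperator, projDiff, h1, h2, h3, h4]

theorem ker_gapOperator : (gapOperator M₁ M₂).ker = limitSpace M₁ M₂ := by
  ext x; exact gapOperator_apply_eq_zero_iff M₁ M₂

theorem drOperator_apply_of_mem {x : X} (hx : x ∈ limitSpace M₁ M₂) :
    drOperator M₁ M₂ x = x := by
  have h1 := norm_sub_drOperator_sq M₁ M₂ x
  rw [(gapOperator_apply_eq_zero_iff M₁ M₂).mpr hx, inner_zero_right, Complex.zero_re,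
    sq_eq_zero_iff, norm_eq_zero, sub_eq_zero] at h1
  exact h1.symm

theorem drOperator_pow_apply_of_mem (n : ℕ) {x : X} (hx : x ∈ limitSpace M₁ M₂) :
    (drOperator M₁ M₂ ^ n) x = x := by
  induction n with
  | zero => simp
  | succ n ih => rw [pow_succ, mul_apply_eq_comp, drOperator_apply_of_mem M₁ M₂ hx, ih]

theorem drOperator_mem_orthogonal {x : X} (hx : x ∈ (limitSpace M₁ M₂)ᗮ) :
    drOperator M₁ M₂ x ∈ (limitSpace M₁ M₂)ᗮ := by
  intro v hv
  have h1 : limitSpace M₂ M₁ = limitSpace M₁ M₂ := by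
    rw [← ker_gapOperator, gapOperator_swap, ker_gapOperator]
  rw [← ContinuousLinearMap.adjoint_inner_left, ← ContinuousLinearMap.star_eq_adjoint,
    star_drOperator, drOperator_apply_of_mem M₂ M₁ (by rwa [h1])]
  exact hx v hv

theorem pow_sub_limitProjection_apply (n : ℕ) (x : X) :
    (drOperator M₁ M₂ ^ n - limitProjection M₁ M₂) x =
      (drOperator M₁ M₂ ^ n) (x - limitProjection M₁ M₂ x) := by
  have h : limitProjection M₁ M₂ x ∈ limitSpace M₁ M₂ := Submodule.starProjection_apply_mem _ _
  rw [sub_apply, map_sub, drOperator_pow_apply_of_mem M₁ M₂ n h]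

theorem sub_limitProjection_mem (x : X) :
    x - limitProjection M₁ M₂ x ∈ (limitSpace M₁ M₂)ᗮ :=
  Submodule.sub_starProjection_mem_orthogonal _

theorem limitProjection_apply_eq_zero {x : X} (hx : x ∈ (limitSpace M₁ M₂)ᗮ) :
    limitProjection M₁ M₂ x = 0 :=
  (Submodule.starProjection_apply_eq_zero_iff _).mpr hx

theorem norm_sub_limitProjection_le (x : X) : ‖x - limitProjection M₁ M₂ x‖ ≤ ‖x‖ := by
  have : x - limitProjection M₁ M₂ x = (limitSpace M₁ M₂)ᗮ.starProjection x := by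
    rw [limitProjection, Submodule.starProjection_orthogonal_val]
  rw [this]
  exact Submodule.norm_starProjection_apply_le _ _

theorem norm_pow_sub_limitProjection_apply_le (n : ℕ) (x : X) :
    ‖(drOperator M₁ M₂ ^ n - limitProjection M₁ M₂) x‖ ≤ ‖x‖ := by
  rw [pow_sub_limitProjection_apply]
  exact (norm_drOperator_pow_apply_le M₁ M₂ n _).trans (norm_sub_limitProjection_le M₁ M₂ x)

/-- A lower bound for the gap operator on a `T`-invariant set of vectors yields geometric decay. -/
theorem norm_drOperator_pow_apply_le_of_invariant {δ : ℝ} (hδ : δ ≤ 1) {s : Set X}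
    (hs : ∀ x ∈ s, drOperator M₁ M₂ x ∈ s)
    (h : ∀ x ∈ s, δ * ‖x‖ ^ 2 ≤ (inner ℂ x (gapOperator M₁ M₂ x)).re) (n : ℕ) {x : X}
    (hx : x ∈ s) : ‖(drOperator M₁ M₂ ^ n) x‖ ≤ √(1 - δ) ^ n * ‖x‖ := by
  have h1 : ∀ x ∈ s, ‖drOperator M₁ M₂ x‖ ≤ √(1 - δ) * ‖x‖ := fun x hx => by
    rw [← sq_le_sq₀ (norm_nonneg _) (by positivity), mul_pow, Real.sq_sqrt (by linarith),
      norm_drOperator_sq]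
    linarith [h x hx]
  have h2 : (drOperator M₁ M₂ ^ n) x ∈ s ∧
      ‖(drOperator M₁ M₂ ^ n) x‖ ≤ √(1 - δ) ^ n * ‖x‖ := by
    induction n with
    | zero => simpa using hx
    | succ n ih =>
      rw [pow_succ', mul_apply_eq_comp]
      refine ⟨hs _ ih.1, (h1 _ ih.1).trans ?_⟩
      rw [pow_succ', mul_assoc]
      exact mul_le_mul_of_nonneg_left ih.2 (Real.sqrt_nonneg _)
  exact h2.2

/-- Orbits of vectors which are spectrally supported in `[δ, ∞)` decay geometrically. -/
theorem norm_drOperator_pow_cfc_le {f : ℝ → ℝ} (hf : Continuous f) {δ : ℝ} (hδ : δ ≤ 1)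
    (h : ∀ t, t < δ → f t = 0) (n : ℕ) (z : X) :
    ‖(drOperator M₁ M₂ ^ n) (cfc f (gapOperator M₁ M₂) z)‖ ≤
      √(1 - δ) ^ n * ‖cfc f (gapOperator M₁ M₂) z‖ := by
  have hB := gapOperator_nonneg M₁ M₂
  refine norm_drOperator_pow_apply_le_of_invariant M₁ M₂ hδ
    (s := Set.range fun w => cfc f (gapOperator M₁ M₂) w) ?_ ?_ n ⟨z, rfl⟩
  · rintro _ ⟨z, rfl⟩
    refine ⟨drOperator M₁ M₂ z, ?_⟩
    have hc := hB.isSelfAdjoint.commute_cfc (commute_gapOperator_drOperator M₁ M₂) f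
    beta_reduce
    rw [← mul_apply_eq_comp, hc.eq, mul_apply_eq_comp]
  · rintro _ ⟨z, rfl⟩
    exact le_re_inner_cfc hB hf (fun t _ => h t) z

theorem cfc_mem_orthogonal {f : ℝ → ℝ} (hf : Continuous f) {δ : ℝ} (hδ : 0 < δ)
    (h : ∀ t, t < δ → f t = 0) (z : X) :
    cfc f (gapOperator M₁ M₂) z ∈ (limitSpace M₁ M₂)ᗮ := by
  rw [Submodule.mem_orthogonal']
  exact fun v hv => inner_cfc_eq_zero_of_ker (gapOperator_nonneg M₁ M₂) hf hδ (fun t _ => h t) z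
    ((gapOperator_apply_eq_zero_iff M₁ M₂).mpr hv)

theorem norm_drOperator_pow_sub_le (n : ℕ) (x : X) :
    ‖(drOperator M₁ M₂ ^ n) x - x‖ ≤ n * ‖x - drOperator M₁ M₂ x‖ := by
  induction n with
  | zero => simp
  | succ n ih =>
    have h1 : (drOperator M₁ M₂ ^ (n + 1)) x - x =
        ((drOperator M₁ M₂ ^ n) x - x) - (drOperator M₁ M₂ ^ n) (x - drOperator M₁ M₂ x) := by
      rw [pow_succ, mul_apply_eq_comp, map_sub]; abel
    rw [h1]
    refine (norm_sub_le _ _).trans ?_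
    rw [Nat.cast_succ]
    linarith [norm_drOperator_pow_apply_le M₁ M₂ n (x - drOperator M₁ M₂ x)]

/-! ### Closedness of the sum of the two subspaces -/

/-- By the open mapping theorem, elements of a closed sum of closed subspaces have decompositions
controlled in norm. -/
theorem exists_decomposition_norm_le
    (h : IsClosed ((M₁.toSubmodule ⊔ M₂.toSubmodule : Submodule ℂ X) : Set X)) :
    ∃ C > 0, ∀ x ∈ M₁.toSubmodule ⊔ M₂.toSubmodule, ∃ u ∈ M₁.toSubmodule, ∃ v ∈ M₂.toSubmodule,
      u + v = x ∧ ‖u‖ ≤ C * ‖x‖ ∧ ‖v‖ ≤ C * ‖x‖ := by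
  have := h.completeSpace_coe
  have := M₁.isClosed.completeSpace_coe
  have := M₂.isClosed.completeSpace_coe
  let f : M₁.toSubmodule × M₂.toSubmodule →L[ℂ] X :=
    M₁.toSubmodule.subtypeL.coprod M₂.toSubmodule.subtypeL
  have hf : ∀ p, f p = p.1 + p.2 := fun p => rfl
  let g : M₁.toSubmodule × M₂.toSubmodule →L[ℂ] (M₁.toSubmodule ⊔ M₂.toSubmodule : Submodule ℂ X) :=
    f.codRestrict _ fun p => by
      rw [hf]; exact Submodule.add_mem_sup p.1.2 p.2.2
  have hg : Function.Surjective g := fun x => by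
    obtain ⟨u, hu, v, hv, huv⟩ := Submodule.mem_sup.mp x.2
    exact ⟨(⟨u, hu⟩, ⟨v, hv⟩), Subtype.ext huv⟩
  obtain ⟨C, hC, H⟩ := g.exists_preimage_norm_le hg
  refine ⟨C, hC, fun x hx => ?_⟩
  obtain ⟨p, hp, hpC⟩ := H ⟨x, hx⟩
  refine ⟨p.1, p.1.2, p.2, p.2.2, congrArg Subtype.val hp, ?_, ?_⟩
  · exact (norm_fst_le p).trans hpC
  · exact (norm_snd_le p).trans hpC

/-- If `M₁ + M₂` is closed, then `(P₁ - P₂)²` is bounded below on the orthogonal complement of its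
kernel. Splitting `x = u + v` with `u ∈ M₁` and `v ∈ M₁ᗮ`, one has
`‖(P₁ - P₂) x‖² = ‖(1 - P₂) u‖² + ‖P₂ v‖²`, and bounded decompositions in `M₁ + M₂` of `(1 - P₂) u`
and of `v` bound `‖u‖` and `‖v‖`. -/
theorem exists_le_re_inner_gapOperator
    (h : IsClosed ((M₁.toSubmodule ⊔ M₂.toSubmodule : Submodule ℂ X) : Set X)) :
    ∃ c > 0, ∀ x ∈ (limitSpace M₁ M₂)ᗮ,
      c * ‖x‖ ^ 2 ≤ (inner ℂ x (gapOperator M₁ M₂ x)).re := by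
  obtain ⟨C, hC, H⟩ := exists_decomposition_norm_le M₁ M₂ h
  refine ⟨(C ^ 2)⁻¹, by positivity, fun x hx => ?_⟩
  rw [← norm_projDiff_sq]
  have hx1 : ∀ w ∈ M₁.toSubmodule ⊓ M₂.toSubmodule, inner ℂ w x = 0 := fun w hw =>
    hx w (Submodule.mem_sup_left hw)
  have hx2 : ∀ w ∈ M₁.toSubmoduleᗮ ⊓ M₂.toSubmoduleᗮ, inner ℂ w x = 0 := fun w hw =>
    hx w (Submodule.mem_sup_right hw)
  set u := M₁.toSubmodule.starProjection x with hu
  set v := x - u with hv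
  have huM : u ∈ M₁.toSubmodule := Submodule.starProjection_apply_mem _ _
  have hvM : v ∈ M₁.toSubmoduleᗮ := Submodule.sub_starProjection_mem_orthogonal _
  have hQ : ∀ w, w - M₂.toSubmodule.starProjection w ∈ M₂.toSubmoduleᗮ := fun w =>
    Submodule.sub_starProjection_mem_orthogonal _
  have hP2 : ∀ w, M₂.toSubmodule.starProjection w ∈ M₂.toSubmodule := fun w =>
    Submodule.starProjection_apply_mem _ _
  have hu0 : ∀ w ∈ M₁.toSubmodule ⊓ M₂.toSubmodule, inner ℂ w u = 0 := fun w hw => by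
    have h1 : inner ℂ w v = 0 := hvM w hw.1
    rw [hv, inner_sub_right, hx1 w hw, zero_sub, neg_eq_zero] at h1
    exact h1
  have hv0 : ∀ w ∈ M₁.toSubmoduleᗮ ⊓ M₂.toSubmoduleᗮ, inner ℂ w v = 0 := fun w hw => by
    rw [hv, inner_sub_right, hx2 w hw, zero_sub, neg_eq_zero]
    exact Submodule.inner_left_of_mem_orthogonal huM hw.1
  have hD : ‖projDiff M₁ M₂ x‖ ^ 2 =
      ‖u - M₂.toSubmodule.starProjection u‖ ^ 2 + ‖M₂.toSubmodule.starProjection v‖ ^ 2 := by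
    have h1 : projDiff M₁ M₂ x =
        (u - M₂.toSubmodule.starProjection u) - M₂.toSubmodule.starProjection v := by
      rw [hv, map_sub, projDiff, sub_apply, ← hu]; abel
    rw [h1, norm_sub_sq (𝕜 := ℂ), Submodule.inner_left_of_mem_orthogonal (hP2 v) (hQ u)]
    simp
  have hxn : ‖x‖ ^ 2 = ‖u‖ ^ 2 + ‖v‖ ^ 2 := by
    have h1 : x = u + v := by rw [hv]; abel
    conv_lhs => rw [h1]
    rw [norm_add_sq (𝕜 := ℂ), Submodule.inner_right_of_mem_orthogonal huM hvM]
    simp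
  have ha : ‖u‖ ≤ C * ‖u - M₂.toSubmodule.starProjection u‖ := by
    obtain ⟨m₁, hm₁, m₂, hm₂, he, hb, -⟩ := H (u - M₂.toSubmodule.starProjection u)
      (Submodule.sub_mem _ (Submodule.mem_sup_left huM) (Submodule.mem_sup_right (hP2 u)))
    have h1 : u - m₁ ∈ M₁.toSubmodule ⊓ M₂.toSubmodule := by
      refine ⟨Submodule.sub_mem _ huM hm₁, ?_⟩
      have h2 : u - m₁ = m₂ + M₂.toSubmodule.starProjection u := by
        rw [sub_eq_iff_eq_add, add_comm, ← add_assoc, he]; abel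
      rw [h2]
      exact Submodule.add_mem _ hm₂ (hP2 u)
    have h2 := hu0 _ h1
    rw [inner_sub_left, sub_eq_zero] at h2
    have h3 : ‖u‖ ^ 2 ≤ ‖m₁‖ * ‖u‖ := by
      rw [← inner_self_eq_norm_sq (𝕜 := ℂ), h2]
      exact re_inner_le_norm m₁ u
    rcases eq_or_lt_of_le (norm_nonneg u) with h4 | h4
    · rw [← h4]; positivity
    · exact (le_of_mul_le_mul_right (by rwa [sq] at h3) h4).trans hb
  have hb : ‖v‖ ≤ C * ‖M₂.toSubmodule.starProjection v‖ := by
    have h0 : v ∈ M₁.toSubmodule ⊔ M₂.toSubmodule := by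
      have := h.completeSpace_coe
      rw [← Submodule.orthogonal_orthogonal (M₁.toSubmodule ⊔ M₂.toSubmodule),
        ← Submodule.inf_orthogonal]
      exact hv0
    obtain ⟨m₁, hm₁, m₂, hm₂, he, -, hb⟩ := H v h0
    have h1 : inner ℂ v v = inner ℂ (M₂.toSubmodule.starProjection v) m₂ := by
      rw [Submodule.inner_starProjection_left_eq_right, Submodule.starProjection_eq_self_iff.mpr hm₂]
      conv_lhs => rw [← he, inner_add_right, he]
      rw [Submodule.inner_left_of_mem_orthogonal hm₁ hvM, zero_add]
    have h3 : ‖v‖ ^ 2 ≤ ‖M₂.toSubmodule.starProjection v‖ * (C * ‖v‖) := by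
      rw [← inner_self_eq_norm_sq (𝕜 := ℂ), h1]
      exact (re_inner_le_norm _ _).trans (mul_le_mul_of_nonneg_left hb (norm_nonneg _))
    rcases eq_or_lt_of_le (norm_nonneg v) with h4 | h4
    · rw [← h4]; positivity
    · refine le_of_mul_le_mul_right ?_ h4
      linarith [sq ‖v‖]
  rw [inv_mul_le_iff₀ (by positivity), hD, hxn, mul_add, ← mul_pow, ← mul_pow]
  gcongr

/-- Conversely, a lower bound for `(P₁ - P₂)²` makes `1 - P₂` bounded below on the part of `M₁`
orthogonal to `M₁ ∩ M₂`, so that `(1 - P₂) M₁`, and hence `M₁ + M₂`, is closed. -/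
theorem isClosed_sup_of_le_re_inner_gapOperator {c : ℝ} (hc : 0 < c)
    (h : ∀ x ∈ (limitSpace M₁ M₂)ᗮ, c * ‖x‖ ^ 2 ≤ (inner ℂ x (gapOperator M₁ M₂ x)).re) :
    IsClosed ((M₁.toSubmodule ⊔ M₂.toSubmodule : Submodule ℂ X) : Set X) := by
  have hA : IsClosed ((M₁.toSubmodule ⊓ M₂.toSubmodule : Submodule ℂ X) : Set X) :=
    M₁.isClosed.inter M₂.isClosed
  set A := M₁.toSubmodule ⊓ M₂.toSubmodule with hAdef
  have hN : IsClosed ((M₁.toSubmodule ⊓ Aᗮ : Submodule ℂ X) : Set X) :=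
    M₁.isClosed.inter (Submodule.isClosed_orthogonal _)
  have := hA.completeSpace_coe
  have := hN.completeSpace_coe
  let Q : X →L[ℂ] X := 1 - M₂.toSubmodule.starProjection
  let g : (M₁.toSubmodule ⊓ Aᗮ : Submodule ℂ X) →L[ℂ] X := Q ∘L Submodule.subtypeL _
  have hg : ∀ w, g w = w - M₂.toSubmodule.starProjection (w : X) := fun w => rfl
  have hanti : AntilipschitzWith (Real.toNNReal (√c)⁻¹) g := by
    refine AddMonoidHomClass.antilipschitz_of_bound g fun w => ?_
    have hw : (w : X) ∈ (limitSpace M₁ M₂)ᗮ := by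
      rw [limitSpace, ← Submodule.inf_orthogonal]
      refine ⟨w.2.2, fun z hz => ?_⟩
      exact Submodule.inner_left_of_mem_orthogonal w.2.1 hz.1
    have h1 := h w hw
    have h2 : projDiff M₁ M₂ (w : X) = g w := by
      rw [projDiff, sub_apply, Submodule.starProjection_eq_self_iff.mpr w.2.1, hg]
    rw [← norm_projDiff_sq, h2] at h1
    rw [Real.coe_toNNReal _ (by positivity), ← div_eq_inv_mul, le_div_iff₀ (by positivity),
      ← sq_le_sq₀ (by positivity) (norm_nonneg _), mul_pow, Real.sq_sqrt hc.le, mul_comm]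
    exact h1
  have hrange : IsClosed (Set.range g) := hanti.isClosed_range g.uniformContinuous
  have heq : ((M₁.toSubmodule ⊔ M₂.toSubmodule : Submodule ℂ X) : Set X) = Q ⁻¹' Set.range g := by
    ext x
    simp only [SetLike.mem_coe, Set.mem_preimage, Set.mem_range]
    have hQ : ∀ w, Q w = w - M₂.toSubmodule.starProjection w := fun w => rfl
    constructor
    · intro hx
      obtain ⟨m₁, hm₁, m₂, hm₂, rfl⟩ := Submodule.mem_sup.mp hx
      obtain ⟨a, haA, ha⟩ : ∃ a ∈ A, m₁ - a ∈ Aᗮ :=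
        ⟨A.starProjection m₁, Submodule.starProjection_apply_mem _ _,
          Submodule.sub_starProjection_mem_orthogonal _⟩
      refine ⟨⟨m₁ - a, Submodule.sub_mem _ hm₁ haA.1, ha⟩, ?_⟩
      rw [hg, hQ]
      change m₁ - a - M₂.toSubmodule.starProjection (m₁ - a) = _
      rw [map_add, map_sub, Submodule.starProjection_eq_self_iff.mpr hm₂,
        Submodule.starProjection_eq_self_iff.mpr haA.2]
      abel
    · rintro ⟨w, hw⟩
      rw [hg, hQ] at hw
      have h1 : x = w + M₂.toSubmodule.starProjection (x - w) := by
        rw [map_sub, add_sub, add_sub_right_comm, hw]; abel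
      rw [h1]
      exact Submodule.add_mem_sup w.2.1 (Submodule.starProjection_apply_mem _ _)
  rw [heq]
  exact hrange.preimage Q.continuous

/-- If `M₁ + M₂` is not closed, then `0` is an accumulation point of the spectrum of
`(P₁ - P₂)²`. -/
theorem exists_mem_spectrum_gapOperator
    (h : ¬ IsClosed ((M₁.toSubmodule ⊔ M₂.toSubmodule : Submodule ℂ X) : Set X)) {ε : ℝ}
    (hε : 0 < ε) : ∃ t ∈ spectrum ℝ (gapOperator M₁ M₂), 0 < t ∧ t < ε := by
  by_contra! hcon
  refine h (isClosed_sup_of_le_re_inner_gapOperator M₁ M₂ hε fun x hx => ?_)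
  rw [← ker_gapOperator] at hx
  exact le_re_inner_of_spectral_gap (gapOperator_nonneg M₁ M₂) hcon hx

/-! ### Arbitrarily slow convergence -/

/-- One step of the construction of almost invariant vectors: below any spectral level `d` there is
a unit vector, spectrally supported in `[d', d]` for some `d' > 0`, whose orbit is almost constant
up to time `N`; from some later time `N'` on, every orbit of a vector supported in `[d', ∞)` is
small. -/
theorem exists_almost_invariant
    (h : ¬ IsClosed ((M₁.toSubmodule ⊔ M₂.toSubmodule : Submodule ℂ X) : Set X)) {r : ℕ → ℝ}
    (hr : Tendsto r atTop (𝓝 0)) {η θ : ℝ} (hη : 0 < η) (hθ : 0 < θ) (N : ℕ) {d : ℝ}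
    (hd : 0 < d) (hd1 : d ≤ 1) :
    ∃ (N' : ℕ) (d' e : ℝ) (z : X), N < N' ∧ 0 < d' ∧ d' ≤ d ∧ e ≤ d ∧
      N * √e ≤ 1 / 2 ∧
      ‖cfc (fun s => threshold d' s * tent e s) (gapOperator M₁ M₂) z‖ = 1 ∧
      (∀ n, N' ≤ n → √(1 - d') ^ n ≤ η) ∧ ∀ n, N' ≤ n → r n ≤ θ := by
  -- unit vectors supported below `e` move by at most `√e` in one step, by at most `1 / 2` in `N`
  let e : ℝ := min d ((2 * (N + 1)) ^ 2)⁻¹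
  have he0 : 0 < e := lt_min hd (by positivity)
  obtain ⟨t, ht, ht0, hte⟩ := exists_mem_spectrum_gapOperator M₁ M₂ h he0
  obtain ⟨z, hz⟩ := exists_unit_cfc_of_mem_spectrum (gapOperator_nonneg M₁ M₂) ht ht0 hte
  have hed : e ≤ d := min_le_left _ _
  have h1 : √(1 - t / 2) < 1 := by
    rw [Real.sqrt_lt' one_pos]; linarith
  have h2 : Tendsto (fun n => √(1 - t / 2) ^ n) atTop (𝓝 0) :=
    tendsto_pow_atTop_nhds_zero_of_lt_one (Real.sqrt_nonneg _) h1
  obtain ⟨N', hN'⟩ := eventually_atTop.mp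
    ((h2.eventually_le_const hη).and (hr.eventually_le_const hθ))
  refine ⟨max N' (N + 1), t / 2, e, z, by simp, by linarith, by linarith, hed, ?_, hz,
    fun n hn => (hN' n ((le_max_left _ _).trans hn)).1,
    fun n hn => (hN' n ((le_max_left _ _).trans hn)).2⟩
  have h3 : √e ≤ (2 * (N + 1 : ℝ))⁻¹ := by
    rw [Real.sqrt_le_left (by positivity), inv_pow]
    exact min_le_right _ _
  calc (N : ℝ) * √e ≤ N * (2 * (N + 1 : ℝ))⁻¹ := by gcongr
    _ ≤ 1 / 2 := by
      rw [← div_eq_mul_inv, div_le_div_iff₀ (by positivity) (by positivity)]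
      linarith

/-- Times `N k`, spectral levels `d k` and unit vectors `y k`, spectrally supported in
`[d (k + 1), d k]`, are chosen one after another, with `N (k + 1)` so large that the orbits of
`y 0, …, y k` and the given sequence have become small. Disjointness of the supports makes the
orbits orthogonal, so that `exists_weak_orbit_ge` applies. -/
theorem weaklyArbitrarilySlow_of_not_isClosed
    (h : ¬ IsClosed ((M₁.toSubmodule ⊔ M₂.toSubmodule : Submodule ℂ X) : Set X)) :
    WeaklyArbitrarilySlow fun n => drOperator M₁ M₂ ^ n - limitProjection M₁ M₂ := by
  intro r hr0 hr
  set B := gapOperator M₁ M₂ with hBdef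
  have hB : 0 ≤ B := gapOperator_nonneg M₁ M₂
  obtain ⟨C, hC⟩ := hr.bddAbove_range
  have hC : ∀ n, r n ≤ C := fun n => hC ⟨n, rfl⟩
  have hC0 : 0 ≤ C := (hr0 0).trans (hC 0)
  -- a state consists of a time and of a spectral level in `(0, 1]`
  let State := {p : ℕ × ℝ // 0 < p.2 ∧ p.2 ≤ 1}
  have hstep : ∀ (k : ℕ) (p : State), ∃ q : State, ∃ (e : ℝ) (z : X), p.1.1 < q.1.1 ∧
      q.1.2 ≤ p.1.2 ∧ e ≤ p.1.2 ∧ p.1.1 * √e ≤ 1 / 2 ∧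
      ‖cfc (fun s => threshold q.1.2 s * tent e s) B z‖ = 1 ∧
      (∀ n, q.1.1 ≤ n → √(1 - q.1.2) ^ n ≤ (81 / 100) ^ (k + 1) / 10) ∧
      ∀ n, q.1.1 ≤ n → r n ≤ (2 * C + 1) * ((81 / 100) ^ (k + 1) / 2) := by
    intro k p
    obtain ⟨N', d', e, z, h1, h2, h3, h4, h5, h6, h7, h8⟩ := exists_almost_invariant M₁ M₂ h hr
      (η := (81 / 100) ^ (k + 1) / 10) (θ := (2 * C + 1) * ((81 / 100) ^ (k + 1) / 2))
      (by positivity) (by positivity) p.1.1 p.2.1 p.2.2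
    exact ⟨⟨(N', d'), h2, h3.trans p.2.2⟩, e, z, h1, h3, h4, h5, h6, h7, h8⟩
  choose F e z hF1 hF2 hF3 hF4 hF5 hF6 hF7 using hstep
  let p : ℕ → State := fun k => Nat.rec ⟨(0, 1), one_pos, le_rfl⟩ (fun k q => F k q) k
  have hp : ∀ k, p (k + 1) = F k (p k) := fun k => rfl
  let N : ℕ → ℕ := fun k => (p k).1.1
  let d : ℕ → ℝ := fun k => (p k).1.2
  let f : ℕ → ℝ → ℝ := fun k s => threshold (d (k + 1)) s * tent (e k (p k)) s
  have hf : ∀ k, Continuous (f k) := fun k => by fun_prop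
  let y : ℕ → X := fun k => cfc (f k) B (z k (p k))
  have hy : ∀ k, ‖y k‖ = 1 := fun k => hF5 k (p k)
  have hd : Antitone d := antitone_nat_of_succ_le fun k => hF2 k (p k)
  have hd0 : ∀ k, 0 < d k := fun k => (p k).2.1
  have hd1 : ∀ k, d k ≤ 1 := fun k => (p k).2.2
  have hN : StrictMono N := strictMono_nat_of_lt_succ fun k => hF1 k (p k)
  have hflow : ∀ k t, t < d (k + 1) → f k t = 0 := fun k t ht => by
    simp only [f]; rw [threshold_of_le ht.le, zero_mul]
  have hfhigh : ∀ k t, e k (p k) < t → f k t = 0 := fun k t ht => by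
    simp only [f]; rw [tent_of_le ht.le, mul_zero]
  have hP : ∀ k, limitProjection M₁ M₂ (y k) = 0 := fun k =>
    limitProjection_apply_eq_zero M₁ M₂ (cfc_mem_orthogonal M₁ M₂ (hf k) (hd0 (k + 1)) (hflow k) _)
  have hSy : ∀ n k, (drOperator M₁ M₂ ^ n - limitProjection M₁ M₂) (y k) =
      (drOperator M₁ M₂ ^ n) (y k) := fun n k => by rw [sub_apply, hP, sub_zero]
  have hff : ∀ j k, j < k → ∀ t, f j t * f k t = 0 := fun j k hjk t => by
    rcases le_or_gt t (d (j + 1)) with ht | ht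
    · simp only [f]; rw [threshold_of_le ht, zero_mul, zero_mul]
    · have : e k (p k) ≤ t := (hF3 k (p k)).trans ((hd (Nat.succ_le_of_lt hjk)).trans ht.le)
      simp only [f]; rw [tent_of_le this, mul_zero, mul_zero]
  exact exists_weak_orbit_ge
    (S := fun n => drOperator M₁ M₂ ^ n - limitProjection M₁ M₂) (y := y) (N := N) (r := r)
    (C := 2 * C + 1) (by positivity) hy
    (fun n k => (norm_pow_sub_limitProjection_apply_le M₁ M₂ n _).trans (hy k).le)
    (fun n j k hjk => by
      rw [hSy]
      refine inner_cfc_cfc_eq_zero hB ((commute_gapOperator_drOperator M₁ M₂).pow_right n) (hf j)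
        (hf k) (fun t => ?_) _ _
      rcases lt_or_gt_of_ne hjk with hlt | hlt
      · exact hff j k hlt t
      · rw [mul_comm]; exact hff k j hlt t)
    rfl hN
    (fun k n hn => by
      rw [hSy]
      have h1 : ‖y k - drOperator M₁ M₂ (y k)‖ ≤ √(e k (p k)) := by
        apply Real.le_sqrt_of_sq_le
        rw [norm_sub_drOperator_sq]
        refine (re_inner_cfc_le hB (hf k) (fun t _ => hfhigh k t) _).trans ?_
        have := hy k
        simp only [y] at this
        rw [this]; simp
      have h2 : ‖(drOperator M₁ M₂ ^ n) (y k) - y k‖ ≤ 1 / 2 :=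
        (norm_drOperator_pow_sub_le M₁ M₂ n (y k)).trans <|
          (mul_le_mul (Nat.cast_le.mpr hn) h1 (norm_nonneg _) (Nat.cast_nonneg _)).trans
            (hF4 k (p k))
      have h3 : inner ℂ (y k) ((drOperator M₁ M₂ ^ n) (y k)) =
          inner ℂ (y k) (y k) + inner ℂ (y k) ((drOperator M₁ M₂ ^ n) (y k) - y k) := by
        rw [← inner_add_right, add_sub_cancel]
      have h4 := (abs_le.mp ((Complex.abs_re_le_norm _).trans
        (norm_inner_le_norm (𝕜 := ℂ) (y k) ((drOperator M₁ M₂ ^ n) (y k) - y k)))).1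
      rw [h3, Complex.add_re, ← RCLike.re_eq_complex_re, inner_self_eq_norm_sq,
        RCLike.re_eq_complex_re]
      rw [hy] at h4 ⊢
      linarith)
    (fun j k n hjk hn => by
      rw [hSy]
      obtain ⟨k, rfl⟩ := Nat.exists_eq_succ_of_ne_zero (Nat.ne_zero_of_lt hjk)
      -- `y j` is supported in `[d (j + 1), ∞)`, hence in `[d (k + 1), ∞)`
      have h1 := norm_drOperator_pow_cfc_le M₁ M₂ (hf j) (hd1 (k + 1))
        (fun t ht => hflow j t (ht.trans_le (hd hjk))) n (z j (p j))
      refine h1.trans ?_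
      have := hy j
      simp only [y] at this
      rw [this, mul_one]
      exact hF6 k (p k) n hn)
    (fun k n hn => by
      rcases k with _ | k
      · -- the constant `2 * C + 1` absorbs `r ≤ C`, all that is known at early times
        rw [pow_zero]; linarith [hC n]
      · exact hF7 k (p k) n hn)

/-! ### Rates of convergence -/

theorem mem_superpolynomialSubmodule_of_mem {x : X} (hx : x ∈ limitSpace M₁ M₂) :
    x ∈ superpolynomialSubmodule fun n => drOperator M₁ M₂ ^ n - limitProjection M₁ M₂ := by
  refine superpolynomiallyFast_of_geometric (q := 0) (C := 0) le_rfl one_pos fun n => ?_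
  have : limitProjection M₁ M₂ x = x := Submodule.starProjection_eq_self_iff.mpr hx
  rw [pow_sub_limitProjection_apply, this]
  simp

theorem cfc_threshold_mem_superpolynomialSubmodule {δ : ℝ} (hδ : 0 < δ) (hδ1 : δ ≤ 1) (z : X) :
    cfc (threshold δ) (gapOperator M₁ M₂) z ∈
      superpolynomialSubmodule fun n => drOperator M₁ M₂ ^ n - limitProjection M₁ M₂ := by
  have h0 : ∀ t, t < δ → threshold δ t = 0 := fun t ht => threshold_of_le ht.le
  have h1 : √(1 - δ) < 1 := by rw [Real.sqrt_lt' one_pos]; linarith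
  refine superpolynomiallyFast_of_geometric (C := ‖cfc (threshold δ) (gapOperator M₁ M₂) z‖)
    (Real.sqrt_nonneg _) h1 fun n => ?_
  rw [sub_apply, limitProjection_apply_eq_zero M₁ M₂
    (cfc_mem_orthogonal M₁ M₂ (continuous_threshold δ) hδ h0 z), sub_zero]
  exact norm_drOperator_pow_cfc_le M₁ M₂ (continuous_threshold δ) hδ1 h0 n z

/-- The closure of the space of fast vectors contains the kernel of `(P₁ - P₂)²` and, since
thresholds approximate the identity, its range. -/
theorem dense_superpolynomialSubmodule :
    Dense (superpolynomialSubmodule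
      (fun n => drOperator M₁ M₂ ^ n - limitProjection M₁ M₂) : Set X) := by
  rw [Submodule.dense_iff_topologicalClosure_eq_top, eq_top_iff]
  set V := superpolynomialSubmodule fun n => drOperator M₁ M₂ ^ n - limitProjection M₁ M₂
  have hB := gapOperator_nonneg M₁ M₂
  have hrange : (gapOperator M₁ M₂).range ≤ V.topologicalClosure := by
    rintro _ ⟨z, rfl⟩
    refine mem_closure_of_tendsto (tendsto_cfc_threshold hB z) ?_
    filter_upwards [Ioc_mem_nhdsGT one_pos] with δ hδ
    exact cfc_threshold_mem_superpolynomialSubmodule M₁ M₂ hδ.1 hδ.2 z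
  have horth : (limitSpace M₁ M₂)ᗮ ≤ V.topologicalClosure := by
    rw [← ker_gapOperator, ContinuousLinearMap.orthogonal_ker,
      ContinuousLinearMap.isSelfAdjoint_iff'.mp hB.isSelfAdjoint]
    exact Submodule.topologicalClosure_minimal _ hrange V.isClosed_topologicalClosure
  intro x _
  rw [← add_sub_cancel (limitProjection M₁ M₂ x) x]
  refine Submodule.add_mem _ (V.le_topologicalClosure ?_) (horth (sub_limitProjection_mem M₁ M₂ x))
  exact mem_superpolynomialSubmodule_of_mem M₁ M₂ (Submodule.starProjection_apply_mem _ _)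

theorem tendsto_pow_sub_limitProjection (x : X) :
    Tendsto (fun n => (drOperator M₁ M₂ ^ n - limitProjection M₁ M₂) x) atTop (𝓝 0) := by
  rw [Metric.tendsto_atTop]
  intro ε hε
  obtain ⟨y, hy, hxy⟩ := (dense_superpolynomialSubmodule M₁ M₂).exists_dist_lt x (half_pos hε)
  obtain ⟨N, hN⟩ := Metric.tendsto_atTop.mp (tendsto_of_superpolynomiallyFast hy) _ (half_pos hε)
  refine ⟨N, fun n hn => ?_⟩
  have h1 := hN n hn
  have h2 := norm_pow_sub_limitProjection_apply_le M₁ M₂ n (x - y)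
  rw [dist_zero_right] at h1 ⊢
  rw [dist_eq_norm] at hxy
  calc _ = ‖(drOperator M₁ M₂ ^ n - limitProjection M₁ M₂) (x - y) +
        (drOperator M₁ M₂ ^ n - limitProjection M₁ M₂) y‖ := by rw [← map_add, sub_add_cancel]
    _ ≤ _ := norm_add_le _ _
    _ < ε := by linarith

theorem exists_norm_pow_sub_limitProjection_le
    (h : IsClosed ((M₁.toSubmodule ⊔ M₂.toSubmodule : Submodule ℂ X) : Set X)) :
    ∃ q : ℝ, 0 ≤ q ∧ q < 1 ∧ ∀ n : ℕ, ‖drOperator M₁ M₂ ^ n - limitProjection M₁ M₂‖ ≤ q ^ n := by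
  obtain ⟨c, hc, H⟩ := exists_le_re_inner_gapOperator M₁ M₂ h
  have hc' : 0 < min c 1 := lt_min hc one_pos
  refine ⟨√(1 - min c 1), Real.sqrt_nonneg _, ?_, fun n => ?_⟩
  · rw [Real.sqrt_lt' one_pos]; linarith
  refine ContinuousLinearMap.opNorm_le_bound _ (by positivity) fun x => ?_
  rw [pow_sub_limitProjection_apply]
  refine (norm_drOperator_pow_apply_le_of_invariant M₁ M₂ (min_le_right c 1)
    (s := ((limitSpace M₁ M₂)ᗮ : Submodule ℂ X)) (fun x hx => drOperator_mem_orthogonal M₁ M₂ hx)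
    (fun x hx => (mul_le_mul_of_nonneg_right (min_le_left c 1) (sq_nonneg _)).trans (H x hx)) n
    (sub_limitProjection_mem M₁ M₂ x)).trans ?_
  exact mul_le_mul_of_nonneg_left (norm_sub_limitProjection_le M₁ M₂ x) (by positivity)

end DouglasRachford

theorem mainTheorem4 {X : Type*} [NormedAddCommGroup X] [InnerProductSpace ℂ X] [CompleteSpace X]
    (M₁ M₂ : ClosedSubmodule ℂ X) (T P : X →L[ℂ] X)
    (hT : T = DouglasRachford.drOperator M₁ M₂)
    (hP : P = DouglasRachford.limitProjection M₁ M₂) :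
    (∀ x : X, Tendsto (fun n : ℕ => ‖(T ^ n) x - P x‖) atTop (𝓝 0)) ∧
    (IsClosed ((M₁.toSubmodule ⊔ M₂.toSubmodule : Submodule ℂ X) : Set X) →
      ∃ C : ℝ, 0 < C ∧ ∃ r : ℝ, 0 ≤ r ∧ r < 1 ∧ ∀ n : ℕ, ‖T ^ n - P‖ ≤ C * r ^ n) ∧
    (¬ IsClosed ((M₁.toSubmodule ⊔ M₂.toSubmodule : Submodule ℂ X) : Set X) →
      DouglasRachford.ArbitrarilySlow (fun n : ℕ => T ^ n - P) ∧
      DouglasRachford.WeaklyArbitrarilySlow (fun n : ℕ => T ^ n - P)) ∧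
    (∃ X₀ : Submodule ℂ X, Dense (X₀ : Set X) ∧
      ∀ x ∈ X₀, DouglasRachford.SuperpolynomiallyFast (fun n : ℕ => T ^ n - P) x) := by
  subst hT hP
  refine ⟨fun x => ?_, fun h => ?_, fun h => ?_, ?_⟩
  · simpa using (DouglasRachford.tendsto_pow_sub_limitProjection M₁ M₂ x).norm
  · obtain ⟨q, hq0, hq1, hq⟩ := DouglasRachford.exists_norm_pow_sub_limitProjection_le M₁ M₂ h
    exact ⟨1, one_pos, q, hq0, hq1, fun n => by rw [one_mul]; exact hq n⟩
  · have hw := DouglasRachford.weaklyArbitrarilySlow_of_not_isClosed M₁ M₂ h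
    exact ⟨hw.arbitrarilySlow, hw⟩
  · exact ⟨_, DouglasRachford.dense_superpolynomialSubmodule M₁ M₂, fun x hx => hx⟩
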